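/- Let $d\ge 2$ and $N\ge 2$ be integers. For $0\le k\le N(d-1)$ let $$|R_{N,d;k}\rangle=\sum_{\substack{0\le i_1,\dots,i_N\le d-1\\ i_1+\dots+i_N=k}}|i_1,\dots,i_N\rangle\in(\mathbb{C}^d)^{\otimes N}$$ be the (unnormalized) restricted Dicke vectors, where $|i_1,\dots,i_N\rangle$ is the standard orthonormal basis. Let $p_0,\dots,p_{N(d-1)}\ge 0$ be real numbers and let $$\rho=\sum_{k=0}^{N(d-1)}p_k\,|R_{N,d;k}\rangle\langle R_{N,d;k}| .$$ Here a state is a positive semidefinite operator (not necessarily normalized). An operator $\rho$ on $(\mathbb{C}^d)^{\otimes N}$ is fully separable if it is a finite sum $\rho=\sum_i\lambda_i\,\rho_i^1\otimes\dots\otimes\rho_i^N$ with $\lambda_i>0$ and states $\rho_i^j$ on $\mathbb{C}^d$. For $S\subseteq\{1,\dots,N\}$, $\rho$ is PPT with respect to $S$ if the operator obtained from $\rho$ by transposing (in the standard basis) the subsystems in $S$ is positive semidefinite. A real sequence $(p_k)_{k=0}^n$ is a solution of the generalized moment problem on $[0,\infty)$ if there are a positive measure $\sigma$ on $\mathbb{R}$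 with support contained in $[0,\infty)$ and finite moments up to order $n$, and a number $M\ge 0$, such that $p_k=\int_0^\infty t^k\,d\sigma(t)$ for $0\le k\le n-1$ and $p_n=\int_0^\infty t^n\,d\sigma(t)+M$. Assume that $N$ is even, and let $S$ be any set of exactly $m=N/2$ subsystems. Then the following conditions are equivalent: (a) $\rho$ is fully separable; (b) $\rho$ is PPT with respect to $S$; (c) the sequence $(p_k)_{k=0}^{N(d-1)}$ is a solution of the generalized moment problem on $[0,\infty)$. Moreover, if $d=2$ and $N$ is odd, then (a), (b) and (c) are equivalent for every set $S$ of exactly $m=\frac{N-1}{2}$ subsystems. -/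

import Mathlib

open scoped ComplexOrder

namespace RestrictedDicke

/-- Operators on `(ℂ^d)^{⊗N}`, written as matrices in the standard orthonormal basis
`|i₁, …, i_N⟩`, `0 ≤ i₁, …, i_N ≤ d - 1`. -/
abbrev Op (N d : ℕ) : Type := Matrix (Fin N → Fin d) (Fin N → Fin d) ℂ

/-- An (unnormalized) state is a positive semidefinite operator. -/
def IsState {ι : Type} [Fintype ι] (ρ : Matrix ι ι ℂ) : Prop := ρ.PosSemidef

/-- The elementary tensor `A₁ ⊗ ⋯ ⊗ A_N` of operators on `ℂ^d`. -/
def tensor {N d : ℕ} (A : Fin N → Matrix (Fin d) (Fin d) ℂ) : Op N d :=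
  Matrix.of fun i j => ∏ a, A a (i a) (j a)

/-- `ρ` is fully separable: `ρ = ∑ᵢ λᵢ ρᵢ¹ ⊗ ⋯ ⊗ ρᵢᴺ` (a finite sum) with local states `ρᵢʲ` and
positive numbers `λᵢ`. -/
def FullySeparable {N d : ℕ} (ρ : Op N d) : Prop :=
  ∃ (n : ℕ) (w : Fin n → ℝ) (σ : Fin n → Fin N → Matrix (Fin d) (Fin d) ℂ),
    (∀ i, 0 < w i) ∧ (∀ i a, IsState (σ i a)) ∧
      ρ = ∑ i, (w i : ℂ) • tensor (σ i)

/-- Transposition of the subsystems in `S`: for every `a ∈ S` the `a`-th row index and the `a`-th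
column index are exchanged. -/
def partialTranspose {N d : ℕ} (S : Finset (Fin N)) (ρ : Op N d) : Op N d :=
  Matrix.of fun i j =>
    ρ (fun a => if a ∈ S then j a else i a) (fun a => if a ∈ S then i a else j a)

/-- `partialTranspose S` acts on elementary tensors by transposing the factors in `S`. -/
theorem partialTranspose_tensor {N d : ℕ} (S : Finset (Fin N))
    (A : Fin N → Matrix (Fin d) (Fin d) ℂ) :
    partialTranspose S (tensor A) = tensor fun a => if a ∈ S then (A a).transpose else A a := by
  ext i j
  simp only [partialTranspose, tensor, Matrix.of_apply]
  refine Finset.prod_congr rfl fun a _ => ?_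
  by_cases h : a ∈ S <;> simp [h]

/-- The PPT property with respect to the set `S` of transposed subsystems. -/
def IsPPT {N d : ℕ} (S : Finset (Fin N)) (ρ : Op N d) : Prop :=
  IsState (partialTranspose S ρ)

/-- The unnormalized restricted Dicke vector `|R_{N,d;k}⟩ = ∑ |i₁, …, i_N⟩`, the sum running over
all `(i₁, …, i_N)` with `i₁ + ⋯ + i_N = k`. -/
def dickeVec (N d k : ℕ) : (Fin N → Fin d) → ℂ :=
  fun i => if ∑ a, (i a : ℕ) = k then 1 else 0

/-- The diagonal restricted Dicke operator `∑_{k=0}^{N(d-1)} p_k |R_{N,d;k}⟩⟨R_{N,d;k}|`. -/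
def diagDicke (N d : ℕ) (p : Fin (N * (d - 1) + 1) → ℝ) : Op N d :=
  ∑ k, (p k : ℂ) • Matrix.vecMulVec (dickeVec N d k) (star (dickeVec N d k))

/-- `(p_k)_{k=0}^n` solves the generalized moment problem on `[0,∞)`: there are a positive measure
`σ` carried by `[0,∞)`, with finite moments up to order `n`, and a number `M ≥ 0` such that
`p_k = ∫ t^k dσ(t)` for `k < n` and `p_n = ∫ t^n dσ(t) + M`. -/
def SolvesGeneralizedMomentProblem {n : ℕ} (p : Fin (n + 1) → ℝ) : Prop :=
  ∃ (σ : MeasureTheory.Measure ℝ) (M : ℝ),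
    σ (Set.Ici 0)ᶜ = 0 ∧ 0 ≤ M ∧
    ∀ k : Fin (n + 1),
      MeasureTheory.IntegrableOn (fun t : ℝ => t ^ (k : ℕ)) (Set.Ici 0) σ ∧
      p k = (∫ t in Set.Ici (0 : ℝ), t ^ (k : ℕ) ∂σ) + (if (k : ℕ) = n then M else 0)

end RestrictedDicke

/-! Put `n = N(d-1)`. All three conditions say that `p` lies in the convex cone spanned by the
points `(s^(n-k) t^k)_k` with `s, t ≥ 0` (`IsAtomic`); `s = 0` is the atom at infinity, which
accounts for `M`.

An atomic `p` gives a separable operator: averaging product vectors over phases that are roots of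
unity kills every coherence between different digit sums (`IsAtomic.fullySeparable`).

Conversely, the partial transpose contains the Hankel matrices `(p_(i+j+e))`, `e ≤ 1`, as principal
submatrices (`IsPPT.hankel_nonneg`), so the functional `X^k ↦ p_k` is nonnegative on `a^2` and `X *
b^2`. Polynomials positive on `[0, ∞)` are sums of these without increase of degree
(`mem_stieltjesCone_of_pos`), and Hahn-Banach separation makes `p` atomic
(`isAtomic_of_forall_pos`). The size of `S` matters only because the Hankel matrices of every needed
order must fit. -/

namespace RestrictedDicke

/-! ### Polynomials positive on the half-line -/

open Polynomial in
/-- The cone of real polynomials generated by `a ^ 2` and `X * b ^ 2` of degree at most `n`. -/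
noncomputable def stieltjesCone (n : ℕ) : AddSubmonoid ℝ[X] :=
  AddSubmonoid.closure {q | ∃ (e : ℕ) (a : ℝ[X]), e ≤ 1 ∧ 2 * a.natDegree + e ≤ n ∧
    q = X ^ e * a ^ 2}

section StieltjesCone

open Polynomial

theorem stieltjesCone_mono {m n : ℕ} (h : m ≤ n) : stieltjesCone m ≤ stieltjesCone n :=
  AddSubmonoid.closure_mono fun _ ⟨e, a, he, ha, hq⟩ => ⟨e, a, he, ha.trans h, hq⟩

theorem X_pow_mul_sq_mem_stieltjesCone {n e : ℕ} {a : ℝ[X]} (he : e ≤ 1)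
    (ha : 2 * a.natDegree + e ≤ n) : X ^ e * a ^ 2 ∈ stieltjesCone n :=
  AddSubmonoid.subset_closure ⟨e, a, he, ha, rfl⟩

/-- The only product of generators that changes shape is `X a^2 * X b^2 = (X a b)^2`, and the degree
bounds still add. -/
theorem mul_mem_stieltjesCone {m n : ℕ} {p q : ℝ[X]} (hp : p ∈ stieltjesCone m)
    (hq : q ∈ stieltjesCone n) : p * q ∈ stieltjesCone (m + n) := by
  induction hp using AddSubmonoid.closure_induction with
  | zero => simp
  | add x y _ _ hx hy => rw [add_mul]; exact add_mem hx hy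
  | mem p hp =>
    obtain ⟨e, a, he, ha, rfl⟩ := hp
    induction hq using AddSubmonoid.closure_induction with
    | zero => simp
    | add x y _ _ hx hy => rw [mul_add]; exact add_mem hx hy
    | mem q hq =>
      obtain ⟨f, b, hf, hb, rfl⟩ := hq
      have hab : (a * b).natDegree ≤ a.natDegree + b.natDegree := natDegree_mul_le
      by_cases h : e + f ≤ 1
      · have := X_pow_mul_sq_mem_stieltjesCone (n := m + n) (a := a * b) h (by omega)
        convert this using 1
        ring
      · obtain ⟨rfl, rfl⟩ : e = 1 ∧ f = 1 := by omega
        have hX : (X * (a * b)).natDegree ≤ 1 + (a * b).natDegree := by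
          simpa using natDegree_mul_le (p := (X : ℝ[X])) (q := a * b)
        have := X_pow_mul_sq_mem_stieltjesCone (n := m + n) (a := X * (a * b)) zero_le_one
          (by omega)
        convert this using 1
        ring

/-- A real polynomial which is positive on `[0, ∞)` lies in the cone generated by the polynomials
`a ^ 2` and `X * b ^ 2` of no larger degree. -/
theorem mem_stieltjesCone_of_pos {q : ℝ[X]} (hq : ∀ t, 0 ≤ t → 0 < q.eval t) :
    q ∈ stieltjesCone q.natDegree := by
  induction hn : q.natDegree using Nat.strong_induction_on generalizing q with
  | _ n ih =>
  have hq0 : q ≠ 0 := by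
    rintro rfl
    simpa using hq 0 le_rfl
  rcases Nat.eq_zero_or_pos n with rfl | hpos
  · rw [eq_C_of_natDegree_eq_zero hn] at hq ⊢
    have h := hq 0 le_rfl
    rw [eval_C] at h
    have := X_pow_mul_sq_mem_stieltjesCone (n := 0) (a := C √(q.coeff 0)) zero_le_one (by simp)
    rwa [← C_pow, Real.sq_sqrt h.le, pow_zero, one_mul] at this
  obtain ⟨z, hz⟩ := IsAlgClosed.exists_aeval_eq_zero ℂ q
    (by rw [degree_eq_natDegree hq0, hn]; exact_mod_cast hpos.ne')
  -- Split off the real factor `f` belonging to the root `z`; the cofactor stays positive on `[0,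
  -- ∞)`, so induction applies and the degrees add exactly.
  have key : ∀ (f r : ℝ[X]) (k : ℕ), q = f * r → f.natDegree = k → 0 < k →
      (∀ t, 0 ≤ t → 0 < f.eval t) → f ∈ stieltjesCone k → q ∈ stieltjesCone n := by
    intro f r k hfr hfk hk hf hfmem
    have hf0 : f ≠ 0 := by rintro rfl; exact hq0 (by simp [hfr])
    have hr0 : r ≠ 0 := by rintro rfl; exact hq0 (by simp [hfr])
    have hdeg : k + r.natDegree = n := by rw [← hn, hfr, natDegree_mul hf0 hr0, hfk]
    have hr : ∀ t, 0 ≤ t → 0 < r.eval t := fun t ht => by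
      have := hq t ht
      rw [hfr, eval_mul] at this
      exact (pos_iff_pos_of_mul_pos this).1 (hf t ht)
    rw [hfr, ← hdeg]
    exact mul_mem_stieltjesCone hfmem (ih _ (by omega) hr rfl)
  by_cases hi : z.im = 0
  · have hroot : q.eval z.re = 0 := by
      have hz' : z = (algebraMap ℝ ℂ) z.re := by
        apply Complex.ext <;> simp [hi]
      rw [hz', aeval_algebraMap_apply] at hz
      simpa using hz
    have hneg : z.re < 0 := by
      by_contra h
      exact (hq _ (not_lt.1 h)).ne' hroot
    obtain ⟨r, hr⟩ := dvd_iff_isRoot.2 hroot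
    refine key (X - C z.re) r 1 hr (natDegree_X_sub_C _) one_pos (fun t ht => ?_) ?_
    · simp only [eval_sub, eval_X, eval_C]
      linarith
    · have h1 := X_pow_mul_sq_mem_stieltjesCone (n := 1) (e := 1) (a := 1) le_rfl (by simp)
      have h2 := X_pow_mul_sq_mem_stieltjesCone (n := 1) (a := C √(-z.re)) zero_le_one (by simp)
      rw [← C_pow, Real.sq_sqrt (neg_nonneg.2 hneg.le)] at h2
      convert add_mem h1 h2 using 1
      simp [sub_eq_add_neg]
  · obtain ⟨r, hr⟩ := quadratic_dvd_of_aeval_eq_zero_im_ne_zero q hz hi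
    have hsum : X ^ 2 - C (2 * z.re) * X + C (‖z‖ ^ 2) = (X - C z.re) ^ 2 + C z.im ^ 2 := by
      rw [← Complex.normSq_eq_norm_sq, Complex.normSq_apply]
      simp only [map_add, map_mul, map_ofNat]
      ring
    rw [hsum] at hr
    refine key _ r 2 hr ?_ two_pos (fun t _ => ?_) ?_
    · rw [← C_pow, natDegree_add_C, natDegree_pow, natDegree_X_sub_C]
    · simp only [eval_add, eval_pow, eval_sub, eval_X, eval_C]
      positivity
    · have h1 := X_pow_mul_sq_mem_stieltjesCone (n := 2) (a := X - C z.re) zero_le_one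
        (by simp)
      have h2 := X_pow_mul_sq_mem_stieltjesCone (n := 2) (a := C z.im) zero_le_one (by simp)
      rw [pow_zero, one_mul] at h1 h2
      exact add_mem h1 h2

end StieltjesCone

/-! ### Convex hulls and moment duality -/

/-- In a finite-dimensional space the convex hull of a compact set is compact. -/
theorem isCompact_convexHull_of_finiteDimensional {E : Type*} [NormedAddCommGroup E]
    [NormedSpace ℝ E] [FiniteDimensional ℝ E] {s : Set E} (hs : IsCompact s) :
    IsCompact (convexHull ℝ s) := by
  rcases s.eq_empty_or_nonempty with rfl | ⟨z₀, hz₀⟩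
  · simp
  let κ := Fin (Module.finrank ℝ E + 1)
  -- By Carathéodory, `finrank + 1` points suffice; shorter combinations are padded with weight `0`
  -- at `z₀`.
  have hK : IsCompact (stdSimplex ℝ κ ×ˢ Set.pi Set.univ fun _ : κ => s) :=
    (isCompact_stdSimplex ℝ κ).prod (isCompact_univ_pi fun _ => hs)
  convert hK.image (f := fun x : (κ → ℝ) × (κ → E) => ∑ i, x.1 i • x.2 i) (by fun_prop) using 1
  ext x
  constructor
  · intro hx
    obtain ⟨ι, _, z, w, hz, hind, hw, hw1, rfl⟩ := eq_pos_convex_span_of_mem_convexHull hx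
    have hcard : Fintype.card ι ≤ Fintype.card κ := by
      rw [Fintype.card_fin]
      exact hind.card_le_finrank_succ.trans (by gcongr; exact Submodule.finrank_le _)
    obtain ⟨e⟩ := Function.Embedding.nonempty_of_card_le hcard
    have hw' : ∀ i, Function.extend e w 0 (e i) = w i := fun i => e.injective.extend_apply _ _ _
    have hz' : ∀ i, Function.extend e z (fun _ => z₀) (e i) = z i :=
      fun i => e.injective.extend_apply _ _ _
    have hout : ∀ j ∉ Set.range e, Function.extend e w 0 j = 0 := fun j hj =>
      Function.extend_apply' _ _ _ hj
    refine ⟨(Function.extend e w 0, Function.extend e z fun _ => z₀), ⟨⟨fun j => ?_, ?_⟩, ?_⟩, ?_⟩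
    · by_cases hj : j ∈ Set.range e
      · obtain ⟨i, rfl⟩ := hj
        simpa only [hw'] using (hw i).le
      · exact (hout j hj).ge
    · rw [← hw1]
      exact (Fintype.sum_of_injective e e.injective _ _ hout fun i => (hw' i).symm).symm
    · intro j _
      by_cases hj : j ∈ Set.range e
      · obtain ⟨i, rfl⟩ := hj
        simpa only [hz'] using hz ⟨i, rfl⟩
      · simpa only [Function.extend_apply' _ _ _ hj] using hz₀
    · refine (Fintype.sum_of_injective e e.injective _ _ (fun j hj => ?_) fun i => ?_).symm
      · simp only [hout j hj, zero_smul]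
      · simp only [hw', hz']
  · rintro ⟨⟨w, z⟩, ⟨hw, hz⟩, rfl⟩
    exact (convex_convexHull ℝ s).sum_mem (fun i _ => hw.1 i) hw.2
      fun i _ => subset_convexHull ℝ s (hz i trivial)

/-- The point `(s ^ n, s ^ (n - 1) t, …, t ^ n)` of the homogeneous moment curve. -/
def momentCurve (n : ℕ) (s t : ℝ) : Fin (n + 1) → ℝ := fun k => s ^ (n - k : ℕ) * t ^ (k : ℕ)

/-- `p` is a finite positive combination of points of the homogeneous moment curve in the closed
first quadrant. -/
def IsAtomic {n : ℕ} (p : Fin (n + 1) → ℝ) : Prop :=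
  ∃ (r : ℕ) (w s t : Fin r → ℝ), (∀ i, 0 < w i) ∧ (∀ i, 0 ≤ s i) ∧ (∀ i, 0 ≤ t i) ∧
    p = ∑ i, w i • momentCurve n (s i) (t i)

theorem isCompact_momentCurve_image (n : ℕ) :
    IsCompact ((fun u => momentCurve n (1 - u) u) '' Set.Icc (0 : ℝ) 1) := by
  refine isCompact_Icc.image ?_
  unfold momentCurve
  fun_prop

/-- Places the curve in an affine hyperplane, so that the cone can be sliced to a compact base. -/
theorem sum_choose_mul_momentCurve (n : ℕ) (u : ℝ) :
    ∑ k : Fin (n + 1), (n.choose k : ℝ) * momentCurve n (1 - u) u k = 1 := by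
  unfold momentCurve
  rw [Fin.sum_univ_eq_sum_range fun k => (n.choose k : ℝ) * ((1 - u) ^ (n - k) * u ^ k)]
  calc _ = (u + (1 - u)) ^ n := by
        rw [add_pow]
        exact Finset.sum_congr rfl fun k _ => by ring
    _ = 1 := by simp

/-- Duality between finite atomic moment sequences and polynomials which are positive on `[0, ∞)`,
including the point at infinity. -/
theorem isAtomic_of_forall_pos {n : ℕ} {p : Fin (n + 1) → ℝ} (hp : ∀ k, 0 ≤ p k)
    (h : ∀ g : Fin (n + 1) → ℝ, (∀ t, 0 ≤ t → 0 < ∑ k, g k * t ^ (k : ℕ)) → 0 < g (Fin.last n) →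
      0 ≤ ∑ k, g k * p k) : IsAtomic p := by
  set K := (fun u => momentCurve n (1 - u) u) '' Set.Icc (0 : ℝ) 1 with hK
  set c : ℝ := ∑ k : Fin (n + 1), (n.choose k : ℝ) * p k with hc
  have hchoose : ∀ k : Fin (n + 1), (0 : ℝ) < n.choose k := fun k => by
    exact_mod_cast Nat.choose_pos (Nat.lt_succ_iff.1 k.2)
  have hterm : ∀ k : Fin (n + 1), 0 ≤ (n.choose k : ℝ) * p k :=
    fun k => mul_nonneg (hchoose k).le (hp k)
  rcases (Finset.sum_nonneg fun k _ => hterm k : 0 ≤ c).eq_or_lt with hc0 | hc0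
  · have hp0 : p = 0 := by
      ext k
      have := (Finset.sum_eq_zero_iff_of_nonneg fun k _ => hterm k).1 hc0.symm k (Finset.mem_univ k)
      exact (mul_eq_zero.1 this).resolve_left (hchoose k).ne'
    exact ⟨0, 0, 0, 0, fun i => i.elim0, fun i => i.elim0, fun i => i.elim0, by simp [hp0]⟩
  have hmem : c⁻¹ • p ∈ convexHull ℝ K := by
    by_contra hnot
    obtain ⟨f, u, hfu, hf⟩ := geometric_hahn_banach_point_closed (convex_convexHull ℝ K)
      (isCompact_convexHull_of_finiteDimensional (isCompact_momentCurve_image n)).isClosed hnot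
    -- The hyperplane functional absorbs the constant `u`, making the separation linear.
    let g : Fin (n + 1) → ℝ := fun k => f (Pi.single k 1) - u * n.choose k
    have hg : ∀ x : Fin (n + 1) → ℝ,
        ∑ k, g k * x k = f x - u * ∑ k : Fin (n + 1), (n.choose k : ℝ) * x k := by
      intro x
      have hx : f x = ∑ k, f (Pi.single k 1) * x k := by
        conv_lhs => rw [pi_eq_sum_univ' x]
        simp [map_sum, mul_comm]
      rw [hx, Finset.mul_sum, ← Finset.sum_sub_distrib]
      exact Finset.sum_congr rfl fun k _ => by simp only [g]; ring
    have hgK : ∀ v ∈ Set.Icc (0 : ℝ) 1, 0 < ∑ k, g k * momentCurve n (1 - v) v k := by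
      intro v hv
      rw [hg, sum_choose_mul_momentCurve, mul_one, sub_pos]
      exact hf _ (subset_convexHull ℝ K ⟨v, hv, rfl⟩)
    have hgp : ∑ k, g k * p k < 0 := by
      rw [hg, ← hc, sub_neg]
      rw [map_smul, smul_eq_mul, inv_mul_lt_iff₀ hc0] at hfu
      linarith
    refine hgp.not_ge (h g (fun t ht => ?_) ?_)
    -- Dehomogenize at `v = t / (1 + t)`, scaling by `(1 + t)^n`.
    · have h1 : (0 : ℝ) < 1 + t := by linarith
      have := mul_pos (pow_pos h1 n) (hgK (t / (1 + t))
        ⟨by positivity, (div_le_one h1).2 (by linarith)⟩)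
      rw [Finset.mul_sum] at this
      refine this.trans_eq (Finset.sum_congr rfl fun k _ => ?_)
      have hs : 1 - t / (1 + t) = 1 / (1 + t) := by field_simp; ring
      have hk : n = (n - k) + k := by have := k.2; omega
      rw [momentCurve, hs, div_pow, div_pow, one_pow]
      have hpow : (1 + t) ^ n = (1 + t) ^ (n - k : ℕ) * (1 + t) ^ (k : ℕ) := by
        rw [← pow_add, ← hk]
      rw [hpow]
      field_simp
    -- The point at infinity `v = 1` reads off the top coefficient.
    · have := hgK 1 (by simp)
      rw [Finset.sum_eq_single (Fin.last n)] at this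
      · simpa [momentCurve] using this
      · intro k _ hk
        have : (n - k : ℕ) ≠ 0 := by
          have := Fin.val_lt_last hk
          omega
        simp [momentCurve, this]
      · simp
  obtain ⟨ι, _, z, w, hz, -, hw, -, hsum⟩ := eq_pos_convex_span_of_mem_convexHull hmem
  choose u hu hzu using fun i => hz (Set.mem_range_self i)
  let e := (Fintype.equivFin ι).symm
  refine ⟨Fintype.card ι, fun i => c * w (e i), fun i => 1 - u (e i), fun i => u (e i),
    fun i => mul_pos hc0 (hw _), fun i => sub_nonneg.2 (hu _).2, fun i => (hu _).1, ?_⟩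
  rw [← smul_inv_smul₀ hc0.ne' p, ← hsum, Finset.smul_sum, ← e.sum_comp]
  exact Finset.sum_congr rfl fun i _ => by rw [smul_smul, ← hzu]

/-! ### Atomic sequences and the moment problem -/

/-- Atomic sequences solve the generalized moment problem. -/
theorem IsAtomic.solvesGeneralizedMomentProblem {n : ℕ} (hn : n ≠ 0) {p : Fin (n + 1) → ℝ}
    (hp : IsAtomic p) : SolvesGeneralizedMomentProblem p := by
  obtain ⟨r, w, s, t, hw, hs, ht, rfl⟩ := hp
  -- If `s i = 0`, the location `t i / 0 = 0` is junk, but its mass vanishes because `n ≠ 0`; that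
  -- atom goes into `M`.
  let σ : MeasureTheory.Measure ℝ :=
    ∑ i, ENNReal.ofReal (w i * s i ^ n) • MeasureTheory.Measure.dirac (t i / s i)
  have hσ : σ (Set.Ici 0)ᶜ = 0 := by
    simp only [σ, MeasureTheory.Measure.coe_finsetSum, Finset.sum_apply]
    refine Finset.sum_eq_zero fun i _ => ?_
    have : 0 ≤ t i / s i := div_nonneg (ht i) (hs i)
    simp [this]
  have hres : σ.restrict (Set.Ici 0) = σ :=
    MeasureTheory.Measure.restrict_eq_self_of_ae_mem (MeasureTheory.mem_ae_iff.2 hσ)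
  have hint : ∀ (k : ℕ) i, MeasureTheory.Integrable (fun x : ℝ => x ^ k)
      (ENNReal.ofReal (w i * s i ^ n) • MeasureTheory.Measure.dirac (t i / s i)) := fun k i =>
    (MeasureTheory.integrable_dirac (by simp)).smul_measure ENNReal.ofReal_ne_top
  refine ⟨σ, ∑ i, w i * if s i = 0 then t i ^ n else 0, hσ, ?_, fun k => ⟨?_, ?_⟩⟩
  · refine Finset.sum_nonneg fun i _ => mul_nonneg (hw i).le ?_
    split_ifs
    exacts [pow_nonneg (ht i) n, le_rfl]
  · rw [MeasureTheory.IntegrableOn, hres]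
    exact MeasureTheory.integrable_finsetSum_measure.2 fun i _ => hint k i
  · rw [hres, MeasureTheory.integral_finsetSum_measure fun i _ => hint k i]
    have hk : (k : ℕ) ≤ n := Nat.lt_succ_iff.1 k.2
    have hM : (if (k : ℕ) = n then ∑ i, w i * (if s i = 0 then t i ^ n else 0) else 0) =
        ∑ i, if (k : ℕ) = n then w i * (if s i = 0 then t i ^ n else 0) else 0 := by
      split_ifs <;> simp
    rw [hM, ← Finset.sum_add_distrib, Finset.sum_apply]
    refine Finset.sum_congr rfl fun i _ => ?_
    rw [MeasureTheory.integral_smul_measure, MeasureTheory.integral_dirac, ENNReal.toReal_ofReal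
      (mul_nonneg (hw i).le (pow_nonneg (hs i) n)), Pi.smul_apply, smul_eq_mul, smul_eq_mul,
      momentCurve, mul_assoc]
    by_cases h0 : s i = 0
    · by_cases hkn : (k : ℕ) = n
      · simp [h0, hkn, hn]
      · have : n - k ≠ 0 := by omega
        simp [h0, hkn, hn, this]
    · have : s i ^ n = s i ^ (n - k : ℕ) * s i ^ (k : ℕ) := by rw [← pow_add, Nat.sub_add_cancel hk]
      rw [this, div_pow]
      simp only [h0, if_false, mul_zero, ite_self, add_zero]
      field_simp

/-- Solutions of the generalized moment problem are atomic. -/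
theorem SolvesGeneralizedMomentProblem.isAtomic {n : ℕ} {p : Fin (n + 1) → ℝ}
    (h : SolvesGeneralizedMomentProblem p) (hp : ∀ k, 0 ≤ p k) : IsAtomic p := by
  obtain ⟨σ, M, -, hM, hσ⟩ := h
  refine isAtomic_of_forall_pos hp fun g hg hlast => ?_
  have heq : ∑ k, g k * p k =
      (∫ t in Set.Ici (0 : ℝ), ∑ k, g k * t ^ (k : ℕ) ∂σ) + g (Fin.last n) * M := by
    rw [MeasureTheory.integral_finsetSum _ fun k _ => (hσ k).1.const_mul (g k)]
    simp only [MeasureTheory.integral_const_mul]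
    have hM' : g (Fin.last n) * M = ∑ k, g k * if (k : ℕ) = n then M else 0 := by
      rw [Finset.sum_eq_single (Fin.last n)]
      · simp
      · intro k _ hk
        simp [(Fin.val_lt_last hk).ne]
      · simp
    rw [hM', ← Finset.sum_add_distrib]
    exact Finset.sum_congr rfl fun k _ => by rw [(hσ k).2, mul_add]
  rw [heq]
  exact add_nonneg (MeasureTheory.setIntegral_nonneg measurableSet_Ici fun t ht => (hg t ht).le)
    (mul_nonneg hlast.le hM)

/-! ### Separable operators are PPT -/

theorem tensor_mul {N d : ℕ} (A B : Fin N → Matrix (Fin d) (Fin d) ℂ) :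
    tensor A * tensor B = tensor fun a => A a * B a := by
  ext i j
  simp only [tensor, Matrix.mul_apply, Matrix.of_apply, ← Finset.prod_mul_distrib]
  rw [Finset.prod_univ_sum, Fintype.piFinset_univ]

theorem conjTranspose_tensor {N d : ℕ} (A : Fin N → Matrix (Fin d) (Fin d) ℂ) :
    (tensor A).conjTranspose = tensor fun a => (A a).conjTranspose := by
  ext i j
  simp [tensor, Matrix.conjTranspose_apply]

open scoped MatrixOrder in
theorem IsState.tensor {N d : ℕ} {A : Fin N → Matrix (Fin d) (Fin d) ℂ}
    (hA : ∀ a, IsState (A a)) : IsState (tensor A) := by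
  choose B hB using fun a => CStarAlgebra.nonneg_iff_eq_star_mul_self.1 (hA a).nonneg
  obtain rfl : A = fun a => (B a).conjTranspose * B a := funext hB
  rw [← tensor_mul, ← conjTranspose_tensor]
  exact Matrix.posSemidef_conjTranspose_mul_self _

/-- Fully separable operators are PPT with respect to every set of subsystems. -/
theorem FullySeparable.isPPT {N d : ℕ} {ρ : Op N d} (h : FullySeparable ρ) (S : Finset (Fin N)) :
    IsPPT S ρ := by
  obtain ⟨n, w, σ, hw, hσ, rfl⟩ := h
  have heq : partialTranspose S (∑ i, (w i : ℂ) • tensor (σ i)) =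
      ∑ i, (w i : ℂ) • tensor fun a => if a ∈ S then (σ i a).transpose else σ i a := by
    simp only [← partialTranspose_tensor]
    ext i j
    simp [partialTranspose, Matrix.sum_apply]
  rw [IsPPT, heq]
  refine Matrix.posSemidef_sum _ fun i _ => Matrix.PosSemidef.smul (IsState.tensor fun a => ?_)
    (by exact_mod_cast (hw i).le)
  split_ifs
  exacts [(hσ i a).transpose, hσ i a]

/-! ### Hankel forms inside the partial transpose -/

/-- A sequence `p_0, …, p_n`, continued by zero. -/
def extendZero {n : ℕ} (p : Fin (n + 1) → ℝ) (k : ℕ) : ℝ :=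
  if h : k < n + 1 then p ⟨k, h⟩ else 0

theorem extendZero_val {n : ℕ} (p : Fin (n + 1) → ℝ) (k : Fin (n + 1)) :
    extendZero p k = p k :=
  dif_pos k.2

theorem sum_val_le {N d : ℕ} (i : Fin N → Fin d) : ∑ a, (i a : ℕ) ≤ N * (d - 1) := by
  calc ∑ a, (i a : ℕ) ≤ ∑ _a : Fin N, (d - 1) :=
        Finset.sum_le_sum fun a _ => Nat.le_sub_one_of_lt (i a).2
    _ = N * (d - 1) := by simp

theorem diagDicke_apply {N d : ℕ} (p : Fin (N * (d - 1) + 1) → ℝ) (i j : Fin N → Fin d) :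
    diagDicke N d p i j =
      if ∑ a, (i a : ℕ) = ∑ a, (j a : ℕ) then (extendZero p (∑ a, (i a : ℕ)) : ℂ) else 0 := by
  have hi : ∑ a, (i a : ℕ) < N * (d - 1) + 1 := Nat.lt_succ_of_le (sum_val_le i)
  rw [diagDicke, Matrix.sum_apply, Finset.sum_eq_single ⟨_, hi⟩]
  · simp [dickeVec, Matrix.vecMulVec_apply, extendZero, hi, eq_comm]
  · intro k _ hk
    have : ¬ ∑ a, (i a : ℕ) = (k : ℕ) := fun h => hk (Fin.ext h.symm)
    simp [dickeVec, Matrix.vecMulVec_apply, this]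
  · simp

theorem exists_fin_sum_eq {ι : Type*} {d : ℕ} (hd : 0 < d) (S : Finset ι) {c : ℕ}
    (hc : c ≤ S.card * (d - 1)) : ∃ f : ι → Fin d, ∑ a ∈ S, (f a : ℕ) = c := by
  classical
  induction S using Finset.induction_on generalizing c with
  | empty => exact ⟨fun _ => ⟨0, hd⟩, by simpa [eq_comm] using hc⟩
  | insert a S ha ih =>
    rw [Finset.card_insert_of_notMem ha, Nat.add_one_mul] at hc
    obtain ⟨f, hf⟩ := ih (c := c - min c (d - 1)) (by omega)
    refine ⟨Function.update f a ⟨min c (d - 1), by omega⟩, ?_⟩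
    rw [Finset.sum_insert ha, Function.update_self, Finset.sum_congr rfl fun b hb => by
      rw [Function.update_of_ne (ne_of_mem_of_not_mem hb ha)], hf]
    simp

/-- Prescribed digit sums on a set of subsystems and on its complement. -/
theorem exists_index {N d : ℕ} (hd : 0 < d) (S : Finset (Fin N)) {b c : ℕ}
    (hb : b ≤ S.card * (d - 1)) (hc : c ≤ (N - S.card) * (d - 1)) :
    ∃ f : Fin N → Fin d, ∑ a ∈ S, (f a : ℕ) = b ∧ ∑ a ∈ Sᶜ, (f a : ℕ) = c := by
  obtain ⟨f, hf⟩ := exists_fin_sum_eq hd S hb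
  obtain ⟨g, hg⟩ := exists_fin_sum_eq hd Sᶜ (c := c) (by simpa [Finset.card_compl] using hc)
  refine ⟨fun a => if a ∈ S then f a else g a, ?_, ?_⟩
  · rw [← hf]
    exact Finset.sum_congr rfl fun a ha => by simp [ha]
  · rw [← hg]
    exact Finset.sum_congr rfl fun a ha => by simp [Finset.mem_compl.1 ha]

theorem sum_ite_mem_val {N d : ℕ} (S : Finset (Fin N)) (i j : Fin N → Fin d) :
    ∑ a, ((if a ∈ S then i a else j a : Fin d) : ℕ) =
      ∑ a ∈ S, (i a : ℕ) + ∑ a ∈ Sᶜ, (j a : ℕ) := by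
  rw [← Finset.sum_add_sum_compl S]
  congr 1
  · exact Finset.sum_congr rfl fun a ha => by simp [ha]
  · exact Finset.sum_congr rfl fun a ha => by simp [Finset.mem_compl.1 ha]

/-- The PPT property yields positive semidefinite Hankel forms. -/
theorem IsPPT.hankel_nonneg {N d : ℕ} (hd : 0 < d) {p : Fin (N * (d - 1) + 1) → ℝ}
    {S : Finset (Fin N)} (h : IsPPT S (diagDicke N d p)) {D e : ℕ}
    (hD : D ≤ S.card * (d - 1)) (hDe : D + e ≤ (N - S.card) * (d - 1)) (x : ℕ → ℝ) :
    0 ≤ ∑ i ∈ Finset.range (D + 1), ∑ j ∈ Finset.range (D + 1),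
      x i * x j * extendZero p (i + j + e) := by
  -- Digit sums `i` on `S` and `i + e` off `S`: after the exchange, row and column sums both equal
  -- `i + j + e`, so no entry is lost.
  choose f hfS hfT using fun i : Fin (D + 1) =>
    exists_index hd S (b := i) (c := i + e) (by omega) (by omega)
  have hsub := (Matrix.PosSemidef.submatrix h f).dotProduct_mulVec_nonneg fun i => (x i : ℂ)
  have hentry : ∀ i j, (partialTranspose S (diagDicke N d p)).submatrix f f i j =
      (extendZero p (i + j + e) : ℂ) := by
    intro i j
    simp only [Matrix.submatrix_apply, partialTranspose, Matrix.of_apply]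
    rw [diagDicke_apply, sum_ite_mem_val, sum_ite_mem_val, hfS, hfT, hfS, hfT, if_pos (by ring)]
    congr 2
    ring
  have heq : star (fun i : Fin (D + 1) => (x i : ℂ)) ⬝ᵥ
      ((partialTranspose S (diagDicke N d p)).submatrix f f).mulVec (fun i => (x i : ℂ)) =
      ((∑ i ∈ Finset.range (D + 1), ∑ j ∈ Finset.range (D + 1),
        x i * x j * extendZero p (i + j + e) : ℝ) : ℂ) := by
    simp only [dotProduct, Matrix.mulVec, hentry, Finset.sum_range, Complex.ofReal_sum,
      Finset.mul_sum]
    refine Finset.sum_congr rfl fun i _ => Finset.sum_congr rfl fun j _ => ?_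
    simp
    ring
  rw [heq] at hsub
  exact_mod_cast hsub

open Polynomial in
/-- The PPT property implies that `p` is atomic, as soon as both parts of the bipartition are large
enough for the Hankel forms of all relevant sizes. -/
theorem IsPPT.isAtomic {N d : ℕ} (hd : 0 < d) {p : Fin (N * (d - 1) + 1) → ℝ}
    (hp : ∀ k, 0 ≤ p k) {S : Finset (Fin N)} (h : IsPPT S (diagDicke N d p))
    (hS : ∀ D e, e ≤ 1 → 2 * D + e ≤ N * (d - 1) →
      D ≤ S.card * (d - 1) ∧ D + e ≤ (N - S.card) * (d - 1)) : IsAtomic p := by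
  refine isAtomic_of_forall_pos hp fun g hg _ => ?_
  -- The Riesz functional `X^k ↦ p_k`.
  let Λ : ℝ[X] →ₗ[ℝ] ℝ := lsum fun k => extendZero p k • LinearMap.id
  have hΛ : ∀ k c, Λ (monomial k c) = c * extendZero p k := fun k c => by
    simp [Λ, lsum, mul_comm]
  have hcone : ∀ q ∈ stieltjesCone (N * (d - 1)), 0 ≤ Λ q := by
    intro q hq
    induction hq using AddSubmonoid.closure_induction with
    | zero => simp
    | add x y _ _ hx hy => rw [map_add]; exact add_nonneg hx hy
    | mem q hq =>
      obtain ⟨e, a, he, ha, rfl⟩ := hq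
      obtain ⟨h1, h2⟩ := hS _ _ he ha
      convert h.hankel_nonneg hd h1 h2 a.coeff using 1
      have : X ^ e * a ^ 2 = ∑ i ∈ Finset.range (a.natDegree + 1),
          ∑ j ∈ Finset.range (a.natDegree + 1), monomial (i + j + e) (a.coeff i * a.coeff j) := by
        conv_lhs => rw [pow_two, a.as_sum_range, Finset.sum_mul_sum, Finset.mul_sum]
        refine Finset.sum_congr rfl fun i _ => ?_
        rw [Finset.mul_sum]
        refine Finset.sum_congr rfl fun j _ => ?_
        rw [monomial_mul_monomial, X_pow_mul_monomial]
      rw [this]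
      simp only [map_sum, hΛ]
  set q : ℝ[X] := ∑ k : Fin (N * (d - 1) + 1), monomial k (g k) with hqdef
  have hq : ∀ t, 0 ≤ t → 0 < q.eval t := fun t ht => by
    simpa [hqdef, eval_finsetSum] using hg t ht
  have hdeg : q.natDegree ≤ N * (d - 1) := natDegree_sum_le_of_forall_le _ _ fun k _ =>
    (natDegree_monomial_le _).trans (Nat.lt_succ_iff.1 k.2)
  have := hcone q (stieltjesCone_mono hdeg (mem_stieltjesCone_of_pos hq))
  simpa only [hqdef, map_sum, hΛ, extendZero_val] using this

/-! ### Separable decompositions by phase averaging -/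

theorem fullySeparable_sum {N d : ℕ} {ι : Type*} [Fintype ι] {w : ι → ℝ}
    {σ : ι → Fin N → Matrix (Fin d) (Fin d) ℂ} (hw : ∀ i, 0 < w i) (hσ : ∀ i a, IsState (σ i a)) :
    FullySeparable (∑ i, (w i : ℂ) • tensor (σ i)) := by
  let e := (Fintype.equivFin ι).symm
  exact ⟨Fintype.card ι, fun i => w (e i), fun i => σ (e i), fun i => hw _, fun i => hσ _,
    (e.sum_comp fun i => (w i : ℂ) • tensor (σ i)).symm⟩

/-- Orthogonality of the powers of a primitive root of unity. -/
theorem sum_range_rootOfUnity {m : ℕ} {ζ : ℂ} (hζ : IsPrimitiveRoot ζ m) {a b : ℕ}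
    (ha : a < m) (hb : b < m) :
    ∑ l ∈ Finset.range m, ζ ^ (l * a) * star (ζ ^ (l * b)) = if a = b then (m : ℂ) else 0 := by
  have hm : m ≠ 0 := by omega
  have hnorm : ∀ k : ℕ, ζ ^ k * star (ζ ^ k) = 1 := fun k => by
    rw [Complex.star_def, Complex.mul_conj, Complex.normSq_eq_norm_sq, norm_pow,
      hζ.norm'_eq_one hm]
    simp
  have hterm : ∀ l, ζ ^ (l * a) * star (ζ ^ (l * b)) = (ζ ^ a * star (ζ ^ b)) ^ l := fun l => by
    rw [mul_pow, ← star_pow, ← pow_mul, ← pow_mul, mul_comm a, mul_comm b]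
  simp only [hterm]
  split_ifs with hab
  · subst hab
    simp only [hnorm, one_pow, Finset.sum_const, Finset.card_range, nsmul_one]
  · have hz1 : ζ ^ a * star (ζ ^ b) ≠ 1 := fun h => hab <| hζ.pow_inj ha hb <| by
      calc ζ ^ a = ζ ^ a * (ζ ^ b * star (ζ ^ b)) := by rw [hnorm, mul_one]
        _ = (ζ ^ a * star (ζ ^ b)) * ζ ^ b := by ring
        _ = ζ ^ b := by rw [h, one_mul]
    have hzm : (ζ ^ a * star (ζ ^ b)) ^ m = 1 := by
      rw [mul_pow, ← star_pow, pow_right_comm, pow_right_comm ζ b, hζ.pow_eq_one]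
      simp
    have := geom_sum_mul (ζ ^ a * star (ζ ^ b)) m
    rw [hzm, sub_self] at this
    exact (mul_eq_zero.1 this).resolve_right (sub_ne_zero.2 hz1)

/-- Local vectors whose tensor powers, averaged over phases, give the Dicke operators of the points
of the moment curve. -/
noncomputable def phaseVec (d : ℕ) (x y : ℝ) (z : ℂ) : Fin d → ℂ :=
  fun j => ((x ^ (d - 1 - j : ℕ) * y ^ (j : ℕ) : ℝ) : ℂ) * z ^ (j : ℕ)

theorem prod_phaseVec {N d : ℕ} (x y : ℝ) (z : ℂ) (i : Fin N → Fin d) :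
    ∏ a, phaseVec d x y z (i a) =
      ((x ^ (N * (d - 1) - ∑ a, (i a : ℕ)) * y ^ (∑ a, (i a : ℕ)) : ℝ) : ℂ) *
        z ^ (∑ a, (i a : ℕ)) := by
  have hsum : ∑ a, (d - 1 - i a : ℕ) = N * (d - 1) - ∑ a, (i a : ℕ) := by
    rw [Finset.sum_tsub_distrib _ fun a _ => Nat.le_sub_one_of_lt (i a).2]
    simp
  simp only [phaseVec, Finset.prod_mul_distrib, ← Complex.ofReal_prod, Finset.prod_pow_eq_pow_sum,
    hsum]

/-- Atomic sequences give fully separable operators. -/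
theorem IsAtomic.fullySeparable {N d : ℕ} {p : Fin (N * (d - 1) + 1) → ℝ} (hp : IsAtomic p) :
    FullySeparable (diagDicke N d p) := by
  obtain ⟨r, w, s, t, hw, hs, ht, rfl⟩ := hp
  set n := N * (d - 1) with hn
  have hζ := Complex.isPrimitiveRoot_exp (n + 1) n.succ_ne_zero
  set ζ := Complex.exp (2 * Real.pi * Complex.I / (n + 1 : ℕ))
  -- Square roots, since projectors are quadratic in the vector; `n + 1` phases, since digit sums
  -- take values in `0, …, n`.
  let v : Fin r × Fin (n + 1) → Fin d → ℂ := fun q =>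
    phaseVec d √(s q.1) √(t q.1) (ζ ^ (q.2 : ℕ))
  convert fullySeparable_sum (N := N) (w := fun q : Fin r × Fin (n + 1) => w q.1 / (n + 1 : ℕ))
    (σ := fun q _ => Matrix.vecMulVec (v q) (star (v q)))
    (fun q => div_pos (hw _) (by positivity))
    (fun q _ => Matrix.posSemidef_vecMulVec_self_star _) using 1
  ext i j
  set A := ∑ a, (i a : ℕ) with hA
  set B := ∑ a, (j a : ℕ) with hB
  have hAn : A < n + 1 := Nat.lt_succ_of_le (sum_val_le i)
  have hBn : B < n + 1 := Nat.lt_succ_of_le (sum_val_le j)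
  have hentry : ∀ q, tensor (fun _ : Fin N => Matrix.vecMulVec (v q) (star (v q))) i j =
      ((√(s q.1) ^ (n - A) * √(t q.1) ^ A * (√(s q.1) ^ (n - B) * √(t q.1) ^ B) : ℝ) : ℂ) *
        (ζ ^ ((q.2 : ℕ) * A) * star (ζ ^ ((q.2 : ℕ) * B))) := by
    intro q
    simp only [tensor, Matrix.of_apply, Matrix.vecMulVec_apply, Pi.star_apply,
      Finset.prod_mul_distrib, ← star_prod, v, prod_phaseVec, ← hn, ← hA, ← hB, ← pow_mul]
    rw [star_mul', Complex.star_def, Complex.conj_ofReal, Complex.ofReal_mul (_ * _) (_ * _)]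
    ring
  have hcurve : ∀ x, √(s x) ^ (n - A) * √(t x) ^ A * (√(s x) ^ (n - A) * √(t x) ^ A) =
      s x ^ (n - A) * t x ^ A := fun x => by
    rw [mul_mul_mul_comm, ← mul_pow, ← mul_pow, Real.mul_self_sqrt (hs x), Real.mul_self_sqrt (ht x)]
  have hn1 : ((n : ℂ) + 1) ≠ 0 := by exact_mod_cast n.succ_ne_zero
  rw [Matrix.sum_apply, Fintype.sum_prod_type, diagDicke_apply]
  simp only [Matrix.smul_apply, hentry, smul_eq_mul, ← Finset.mul_sum, ← Finset.sum_range
    fun l => ζ ^ (l * A) * star (ζ ^ (l * B)), sum_range_rootOfUnity hζ hAn hBn]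
  split_ifs with hAB
  · rw [extendZero, dif_pos hAn, Finset.sum_apply, Complex.ofReal_sum]
    refine Finset.sum_congr rfl fun x _ => ?_
    rw [← hA, ← hB] at hAB
    rw [← hAB, hcurve]
    simp only [← hA, ← hn, Pi.smul_apply, smul_eq_mul, momentCurve]
    push_cast
    field_simp
  · simp

end RestrictedDicke

/-! ### The equivalences -/

theorem theoremt (d N : ℕ) (hd : 2 ≤ d) (hN : 2 ≤ N)
    (p : Fin (N * (d - 1) + 1) → ℝ) (hp : ∀ k, 0 ≤ p k) :
    (Even N → ∀ S : Finset (Fin N), S.card = N / 2 →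
      List.TFAE
        [RestrictedDicke.FullySeparable (RestrictedDicke.diagDicke N d p),
         RestrictedDicke.IsPPT S (RestrictedDicke.diagDicke N d p),
         RestrictedDicke.SolvesGeneralizedMomentProblem p]) ∧
    (d = 2 → Odd N → ∀ S : Finset (Fin N), S.card = (N - 1) / 2 →
      List.TFAE
        [RestrictedDicke.FullySeparable (RestrictedDicke.diagDicke N d p),
         RestrictedDicke.IsPPT S (RestrictedDicke.diagDicke N d p),
         RestrictedDicke.SolvesGeneralizedMomentProblem p]) := by
  have hn : N * (d - 1) ≠ 0 := Nat.mul_ne_zero (by omega) (by omega)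
  have main : ∀ S : Finset (Fin N), (∀ D e, e ≤ 1 → 2 * D + e ≤ N * (d - 1) →
      D ≤ S.card * (d - 1) ∧ D + e ≤ (N - S.card) * (d - 1)) →
      List.TFAE
        [RestrictedDicke.FullySeparable (RestrictedDicke.diagDicke N d p),
         RestrictedDicke.IsPPT S (RestrictedDicke.diagDicke N d p),
         RestrictedDicke.SolvesGeneralizedMomentProblem p] := by
    intro S hS
    tfae_have 1 → 2 := fun h => h.isPPT S
    tfae_have 2 → 3 := fun h => (h.isAtomic (by omega) hp hS).solvesGeneralizedMomentProblem hn
    tfae_have 3 → 1 := fun h => (h.isAtomic hp).fullySeparable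
    tfae_finish
  refine ⟨fun ⟨m, hm⟩ S hS => main S fun D e he h => ?_,
    fun hd2 ⟨m, hm⟩ S hS => main S fun D e he h => ?_⟩
  -- Each side has capacity `m(d-1)`; for `e = 1`, parity of `2m(d-1)` gives `D + 1 ≤ m(d-1)`.
  · have h1 : S.card = m := by omega
    have h2 : N - S.card = m := by omega
    rw [h2, h1]
    rw [hm, add_mul] at h
    omega
  -- For `d = 2` the complement has one subsystem more than `S`, which absorbs the shift `e`.
  · subst hd2
    omega
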